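/- \textbf{Definitions.} A \emph{subordination} $S\colon A\to B$ between boolean algebras is a relation $S\subseteq A\times B$ such that (S1) $0\,S\,0$ and $1\,S\,1$; (S2) $a,b\,S\,c$ implies $(a\vee b)\,S\,c$; (S3) $a\,S\,c,d$ implies $a\,S\,(c\wedge d)$; (S4) $a\le b\,S\,c\le d$ implies $a\,S\,d$. An \emph{$\mathsf{S5}$-subordination algebra} is a pair $\mathbf B=(B,S)$ where $B$ is a boolean algebra and $S$ is a subordination on $B$ such that (S5) $a\,S\,b$ implies $a\le b$; (S6) $a\,S\,b$ implies $\neg b\,S\,\neg a$; (S7) $a\,S\,b$ implies $a\,S\,c\,S\,b$ for some $c$. It is a \emph{de Vries algebra} if $B$ is complete and (S8) each $a\ne0$ admits $b\neq 0$ with $b\,S\,a$. A subordination $T\colon(B_1,S_1)\to(B_2,S_2)$ is \emph{compatible} if $T\circ S_1=T=S_2\circ T$; writing $b\,\widehat T\,a$ for $\neg a\,T\,\neg b$, it is \emph{continuous} if for all $b_1\,S_2\,b_2$ there is $a\in\widehat T[b_1]$ with $\widehat T[b_2]\subseteq S_1[a]$. Let $\mathsf{SubS5^S}$ be the category of $\mathsf{S5}$-subordination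 algebras and compatible subordinations, with relational composition and with $S$ as the identity of $(B,S)$; let $\mathsf{DeV^S}$ be its full subcategory of de Vries algebras, with inclusion $\Delta$; let $\mathsf{SubS5^{CS}}$ and $\mathsf{DeV^{CS}}$ be the wide subcategories of $\mathsf{SubS5^S}$ and $\mathsf{DeV^S}$ whose morphisms are the continuous compatible subordinations. In a frame write $a^*$ for the pseudocomplement of $a$, and $a\prec b$ if $a^*\vee b=1$. A frame is \emph{compact regular} if $1$ is compact and $a=\bigvee\{x\mid x\prec a\}$ for every $a$. Let $\mathsf{KRFrm^P}$ be the category of compact regular frames and preframe homomorphisms (maps preserving finite meets and directed joins). A preframe homomorphism $\Box\colon L\to M$ is a \emph{$\mathsf c$-morphism} if there is a map $\Diamond\colon L\to M$ preserving arbitrary joins with $\Box(a\vee b)\le\Box a\vee\Diamond b$ and $\Box a\wedge\Diamond b\le\Diamond(a\wedge b)$ for all $a,b\in L$; let $\mathsf{KRFrm^C}$ be the wide subcategory of $\mathsf{KRFrm^P}$ whose morphisms are the $\mathsf c$-morphisms. Let $\mathcal{RI}\colon\mathsf{SubS5^S}\to\mathsf{KRFrm^P}$ be the contravariant functor sending $(B,S)$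 to the frame (under inclusion) of its \emph{round ideals}, that is, ideals $I$ such that each $a\in I$ has some $b\in I$ with $a\,S\,b$, and sending $T\colon \mathbf B_1\to \mathbf B_2$ to $I\mapsto T^{-1}[I]$. Let $\mathfrak B\colon\mathsf{KRFrm^P}\to\mathsf{DeV^S}$ be the contravariant functor sending $L$ to $\{a\in L\mid a=a^{**}\}$ with the restriction of $\prec$, and $\Box\colon L\to M$ to the relation $\mathfrak B(\Box)\colon\mathfrak B M\to\mathfrak B L$ given by $b\,\mathfrak B(\Box)\,a$ iff $b\prec\Box a$. \textbf{Theorem.} \begin{enumerate} \item The functors $\mathcal{RI}$ and $\Delta\circ\mathfrak B$, together with natural isomorphisms whose components are $Q_{\mathbf B}\colon\mathbf B\to\mathfrak B(\mathcal{RI}(\mathbf B))$, $a\,Q_{\mathbf B}\,I$ iff $a\in I$, and $f_L\colon L\to\mathcal{RI}(\mathfrak B L)$, $f_L(a)=\{b\in \mathfrak B L\mid b\prec a\}$, form a dual equivalence between $\mathsf{SubS5^S}$ and $\mathsf{KRFrm^P}$, and this dual equivalence restricts to a dual equivalence between the wide subcategories $\mathsf{SubS5^{CS}}$ and $\mathsf{KRFrm^C}$.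 \item The functors $\mathcal{RI}\circ\Delta$ and $\mathfrak B$, together with the natural isomorphisms with the same components, form a dual equivalence between $\mathsf{DeV^S}$ and $\mathsf{KRFrm^P}$, and this dual equivalence restricts to a dual equivalence between the wide subcategories $\mathsf{DeV^{CS}}$ and $\mathsf{KRFrm^C}$. \end{enumerate} Here a dual equivalence \emph{restricts} to wide subcategories if both functors map morphisms of one subcategory to morphisms of the other, and the restricted functors, with the same unit and counit, form a dual equivalence of the subcategories. -/

import Mathlib

open CategoryTheory Opposite

universe u v w v' w' v₁ w₁ v₂ w₂

namespace S5Sub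

/-! ### Subordinations -/

/-- A subordination `S : A → B` between boolean algebras. -/
structure IsSubordination {A : Type u} {B : Type v} [BooleanAlgebra A] [BooleanAlgebra B]
    (S : A → B → Prop) : Prop where
  bot_bot : S ⊥ ⊥
  top_top : S ⊤ ⊤
  sup_left : ∀ a b c, S a c → S b c → S (a ⊔ b) c
  inf_right : ∀ a c d, S a c → S a d → S a (c ⊓ d)
  mono : ∀ a b c d, a ≤ b → S b c → c ≤ d → S a d

/-- An `S5`-subordination on a boolean algebra. -/
structure IsS5 {B : Type u} [BooleanAlgebra B] (S : B → B → Prop) : Prop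
    extends IsSubordination S where
  le : ∀ a b, S a b → a ≤ b
  compl : ∀ a b, S a b → S bᶜ aᶜ
  interpolate : ∀ a b, S a b → ∃ c, S a c ∧ S c b

/-- `S5`-subordination algebras `(B, S)`: the objects of the category `SubS5^S`. -/
structure SubS5 : Type (u + 1) where
  carrier : Type u
  [booleanAlgebra : BooleanAlgebra carrier]
  S : carrier → carrier → Prop
  isS5 : IsS5 S

instance : CoeSort SubS5.{u} (Type u) := ⟨SubS5.carrier⟩

instance (B : SubS5.{u}) : BooleanAlgebra B := B.booleanAlgebra

/-- Compatible subordinations `T : A → B`, that is, subordinations such that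
`T ∘ S_A = T = S_B ∘ T`. (`Relation.Comp r p` is "first `r`, then `p`".) -/
@[ext]
structure SubS5.Hom (A B : SubS5.{u}) where
  rel : A → B → Prop
  isSubordination : IsSubordination rel
  comp_left : Relation.Comp A.S rel = rel
  comp_right : Relation.Comp rel B.S = rel

theorem comp_isSubordination {A B C : Type u} [BooleanAlgebra A] [BooleanAlgebra B]
    [BooleanAlgebra C] {T : A → B → Prop} {U : B → C → Prop}
    (hT : IsSubordination T) (hU : IsSubordination U) :
    IsSubordination (Relation.Comp T U) where
  bot_bot := ⟨⊥, hT.bot_bot, hU.bot_bot⟩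
  top_top := ⟨⊤, hT.top_top, hU.top_top⟩
  sup_left := by
    rintro a b c ⟨x, hx, hx'⟩ ⟨y, hy, hy'⟩
    exact ⟨x ⊔ y, hT.sup_left _ _ _ (hT.mono _ _ _ _ le_rfl hx le_sup_left)
      (hT.mono _ _ _ _ le_rfl hy le_sup_right), hU.sup_left _ _ _ hx' hy'⟩
  inf_right := by
    rintro a c d ⟨x, hx, hx'⟩ ⟨y, hy, hy'⟩
    exact ⟨x ⊓ y, hT.inf_right _ _ _ hx hy, hU.inf_right _ _ _
      (hU.mono _ _ _ _ inf_le_left hx' le_rfl) (hU.mono _ _ _ _ inf_le_right hy' le_rfl)⟩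
  mono := by
    rintro a b c d hab ⟨x, hx, hx'⟩ hcd
    exact ⟨x, hT.mono _ _ _ _ hab hx le_rfl, hU.mono _ _ _ _ le_rfl hx' hcd⟩

theorem IsS5.comp_self {B : Type u} [BooleanAlgebra B] {S : B → B → Prop} (h : IsS5 S) :
    Relation.Comp S S = S := by
  funext a b
  refine propext ⟨?_, h.interpolate a b⟩
  rintro ⟨c, hac, hcb⟩
  exact h.mono _ _ _ _ (h.le _ _ hac) hcb le_rfl

/-- The category `SubS5^S`: the identity of `(B, S)` is `S`, composition is relational. -/
instance : Category SubS5.{u} where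
  Hom := SubS5.Hom
  id B := ⟨B.S, B.isS5.toIsSubordination, B.isS5.comp_self, B.isS5.comp_self⟩
  comp T U :=
    { rel := Relation.Comp T.rel U.rel
      isSubordination := comp_isSubordination T.isSubordination U.isSubordination
      comp_left := by rw [← Relation.comp_assoc, T.comp_left]
      comp_right := by rw [Relation.comp_assoc, U.comp_right] }
  id_comp T := SubS5.Hom.ext T.comp_left
  comp_id T := SubS5.Hom.ext T.comp_right
  assoc _ _ _ := SubS5.Hom.ext Relation.comp_assoc

/-- De Vries algebras: compingent algebras whose boolean algebra is complete. -/
def IsDeVries : ObjectProperty SubS5.{u} := fun B =>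
  (∀ a : B, a ≠ ⊥ → ∃ b : B, b ≠ ⊥ ∧ B.S b a) ∧ ∀ s : Set B, ∃ a : B, IsLUB s a

/-- `DeV^S`, the full subcategory of `SubS5^S` on the de Vries algebras. -/
abbrev DeVS : Type (u + 1) := IsDeVries.{u}.FullSubcategory

/-- The inclusion `Δ : DeV^S ⥤ SubS5^S`. -/
abbrev inclΔ : DeVS.{u} ⥤ SubS5.{u} := IsDeVries.{u}.ι

/-- The relation `T̂ : B → A`, given by `b T̂ a` iff `¬a T ¬b`. -/
def hat {A B : Type u} [BooleanAlgebra A] [BooleanAlgebra B] (T : A → B → Prop) :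
    B → A → Prop := fun b a => T aᶜ bᶜ

/-- Continuity of a compatible subordination `T : A → B`: whenever `b₁ S_B b₂` there is
`a ∈ T̂[b₁]` with `T̂[b₂] ⊆ S_A[a]`. -/
def IsContinuous : MorphismProperty SubS5.{u} := fun A B T =>
  ∀ b₁ b₂ : B, B.S b₁ b₂ →
    ∃ a : A, hat T.rel b₁ a ∧ ∀ c : A, hat T.rel b₂ c → A.S a c

instance : IsContinuous.{u}.IsMultiplicative where
  id_mem B := by
    intro b₁ b₂ h
    obtain ⟨c, h₁, h₂⟩ := B.isS5.interpolate _ _ h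
    refine ⟨c, B.isS5.compl _ _ h₁, fun d hd => ?_⟩
    have hd' := B.isS5.compl _ _ hd
    rw [compl_compl, compl_compl] at hd'
    exact B.isS5.mono _ _ _ _ (B.isS5.le _ _ h₂) hd' le_rfl
  comp_mem := by
    intro A B C T U hT hU c₁ c₂ h
    obtain ⟨c, h₁, h₂⟩ := C.isS5.interpolate _ _ h
    obtain ⟨b₁, hb₁, hb₁'⟩ := hU _ _ h₁
    obtain ⟨b₂, hb₂, hb₂'⟩ := hU _ _ h₂
    obtain ⟨a, ha, ha'⟩ := hT _ _ (hb₁' _ hb₂)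
    refine ⟨a, ⟨b₁ᶜ, ha, hb₁⟩, ?_⟩
    rintro d ⟨b, hdb, hbc⟩
    refine ha' d (T.isSubordination.mono _ _ _ _ le_rfl hdb ?_)
    have hb : hat U.rel c₂ bᶜ := by
      change U.rel bᶜᶜ c₂ᶜ
      rwa [compl_compl]
    exact le_compl_comm.mp (B.isS5.le _ _ (hb₂' _ hb))

/-- `SubS5^CS`: the wide subcategory of `SubS5^S` on the continuous compatible subordinations. -/
abbrev SubS5CS : Type (u + 1) := WideSubcategory IsContinuous.{u}

/-- Continuity of morphisms of `DeV^S`. -/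
abbrev IsContinuousDeV : MorphismProperty DeVS.{u} := fun _ _ T => IsContinuous T.hom

instance : IsContinuousDeV.{u}.IsMultiplicative where
  id_mem B := IsContinuous.{u}.id_mem B.obj
  comp_mem T U hT hU := IsContinuous.{u}.comp_mem T.hom U.hom hT hU

/-- `DeV^CS`: the wide subcategory of `DeV^S` on the continuous compatible subordinations. -/
abbrev DeVCS : Type (u + 1) := WideSubcategory IsContinuousDeV.{u}

/-! ### Compact regular frames -/

/-- The well-inside relation `a ≺ b` of a frame: `a* ∨ b = 1`. -/
def WellInside {L : Type u} [Order.Frame L] (a b : L) : Prop := aᶜ ⊔ b = ⊤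

/-- Compact regular frames. -/
structure IsCompactRegular (L : Type u) [Order.Frame L] : Prop where
  compact : IsCompactElement (⊤ : L)
  regular : ∀ a : L, sSup {x | WellInside x a} = a

/-- Compact regular frames: the objects of the category `KRFrm^P`. -/
structure KRFrmP : Type (u + 1) where
  carrier : Type u
  [frame : Order.Frame carrier]
  isCompactRegular : IsCompactRegular carrier

instance : CoeSort KRFrmP.{u} (Type u) := ⟨KRFrmP.carrier⟩

instance (L : KRFrmP.{u}) : Order.Frame L := L.frame

/-- Preframe homomorphisms: maps preserving finite meets and (nonempty) directed joins. -/
@[ext]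
structure PreframeHom (L M : Type u) [Order.Frame L] [Order.Frame M] where
  toFun : L → M
  map_top : toFun ⊤ = ⊤
  map_inf : ∀ a b, toFun (a ⊓ b) = toFun a ⊓ toFun b
  map_sSup : ∀ s : Set L, s.Nonempty → DirectedOn (· ≤ ·) s →
    toFun (sSup s) = sSup (toFun '' s)

theorem PreframeHom.monotone {L M : Type u} [Order.Frame L] [Order.Frame M]
    (f : PreframeHom L M) : Monotone f.toFun := fun a b h => by
  have := f.map_inf a b
  rw [inf_eq_left.mpr h] at this
  exact inf_eq_left.mp this.symm

/-- The category `KRFrm^P` of compact regular frames and preframe homomorphisms. -/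
instance : Category KRFrmP.{u} where
  Hom L M := PreframeHom L M
  id L := ⟨id, rfl, fun _ _ => rfl, fun s _ _ => by simp⟩
  comp f g :=
    { toFun := g.toFun ∘ f.toFun
      map_top := by simp [f.map_top, g.map_top]
      map_inf := by simp [f.map_inf, g.map_inf]
      map_sSup := fun s hs hd => by
        have hd' : DirectedOn (· ≤ ·) (f.toFun '' s) := by
          rintro _ ⟨x, hx, rfl⟩ _ ⟨y, hy, rfl⟩
          obtain ⟨z, hz, hxz, hyz⟩ := hd x hx y hy
          exact ⟨_, ⟨z, hz, rfl⟩, f.monotone hxz, f.monotone hyz⟩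
        simp only [Function.comp_apply]
        rw [f.map_sSup s hs hd, g.map_sSup _ (hs.image _) hd', Set.image_image] }

/-- `c`-morphisms: preframe homomorphisms `□` for which there is a join-preserving `◇` with
`□(a ∨ b) ≤ □a ∨ ◇b` and `□a ∧ ◇b ≤ ◇(a ∧ b)`. -/
def IsCMorphism : MorphismProperty KRFrmP.{u} := fun L M f =>
  ∃ dia : sSupHom L M,
    (∀ a b : L, f.toFun (a ⊔ b) ≤ f.toFun a ⊔ dia b) ∧
    (∀ a b : L, f.toFun a ⊓ dia b ≤ dia (a ⊓ b))

instance : IsCMorphism.{u}.IsMultiplicative where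
  id_mem L := ⟨sSupHom.id L, fun _ _ => le_rfl, fun _ _ => le_rfl⟩
  comp_mem := by
    rintro L M N f g ⟨d, hd, hd'⟩ ⟨e, he, he'⟩
    refine ⟨e.comp d, fun a b => ?_, fun a b => ?_⟩
    · exact (PreframeHom.monotone g (hd a b)).trans (he _ _)
    · exact (he' _ _).trans (OrderHomClass.mono e (hd' a b))

/-- `KRFrm^C`: the wide subcategory of `KRFrm^P` on the `c`-morphisms. -/
abbrev KRFrmC : Type (u + 1) := WideSubcategory IsCMorphism.{u}

/-! ### The frame of round ideals -/

/-- Round ideals of `(B, S)`: ideals `I` such that every `a ∈ I` has some `b ∈ I` with `a S b`. -/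
structure RoundIdeal (B : SubS5.{u}) extends Order.Ideal B where
  round : ∀ a ∈ carrier, ∃ b ∈ carrier, B.S a b

namespace RoundIdeal

variable {B : SubS5.{u}}

instance : SetLike (RoundIdeal B) B where
  coe I := I.carrier
  coe_injective := by
    rintro ⟨I, hI⟩ ⟨J, hJ⟩ h
    have : I = J := SetLike.coe_injective h
    subst this
    rfl

/-- Round ideals are ordered by inclusion. -/
instance : PartialOrder (RoundIdeal B) := .ofSetLike (RoundIdeal B) B

theorem le_def {I J : RoundIdeal B} : I ≤ J ↔ ∀ a ∈ I, a ∈ J := Iff.rfl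

theorem exists_rel (I : RoundIdeal B) {a : B} (h : a ∈ I) : ∃ b ∈ I, B.S a b := I.round a h

theorem mem_of_le (I : RoundIdeal B) {a b : B} (h : a ≤ b) (hb : b ∈ I) : a ∈ I :=
  I.toIdeal.lower h hb

theorem bot_mem (I : RoundIdeal B) : ⊥ ∈ I := Order.Ideal.bot_mem I.toIdeal

theorem sup_mem (I : RoundIdeal B) {a b : B} (ha : a ∈ I) (hb : b ∈ I) : a ⊔ b ∈ I :=
  Order.Ideal.sup_mem (s := I.toIdeal) ha hb

/-- A subset that satisfies the closure conditions gives a round ideal. -/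
def mk' (s : Set B) (hbot : ⊥ ∈ s) (hle : ∀ a b, a ≤ b → b ∈ s → a ∈ s)
    (hsup : ∀ a b, a ∈ s → b ∈ s → a ⊔ b ∈ s) (hround : ∀ a ∈ s, ∃ b ∈ s, B.S a b) :
    RoundIdeal B where
  carrier := s
  lower' := fun a b h ha => hle b a h ha
  nonempty' := ⟨⊥, hbot⟩
  directed' := fun a ha b hb => ⟨a ⊔ b, hsup a b ha hb, le_sup_left, le_sup_right⟩
  round := hround

@[simp]
theorem mem_mk' {s : Set B} {h₁ h₂ h₃ h₄} {a : B} :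
    a ∈ (mk' (B := B) s h₁ h₂ h₃ h₄) ↔ a ∈ s := Iff.rfl

/-- The join of a set of round ideals: the ideal generated by their union. -/
instance : SupSet (RoundIdeal B) where
  sSup F := mk' {a | ∃ t : Finset B, (∀ x ∈ t, ∃ I ∈ F, x ∈ I) ∧ a ≤ t.sup id}
    ⟨∅, by simp, by simp⟩
    (fun a b hab ⟨t, ht, hb⟩ => ⟨t, ht, hab.trans hb⟩)
    (by
      classical
      rintro a b ⟨t, ht, hat⟩ ⟨r, hr, hbr⟩
      refine ⟨t ∪ r, fun x hx => (Finset.mem_union.mp hx).elim (ht x) (hr x), ?_⟩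
      rw [Finset.sup_union]
      exact sup_le_sup hat hbr)
    (by
      classical
      rintro a ⟨t, ht, hat⟩
      have key : ∃ r : Finset B, (∀ x ∈ r, ∃ I ∈ F, x ∈ I) ∧ B.S (t.sup id) (r.sup id) := by
        clear hat
        induction t using Finset.induction_on with
        | empty => exact ⟨∅, by simp, by simpa using B.isS5.bot_bot⟩
        | insert y t _ ih =>
          obtain ⟨r, hr, hr'⟩ := ih fun x hx => ht x (Finset.mem_insert_of_mem hx)
          obtain ⟨I, hI, hyI⟩ := ht y (Finset.mem_insert_self _ _)
          obtain ⟨z, hz, hyz⟩ := I.exists_rel hyI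
          refine ⟨insert z r, fun x hx => ?_, ?_⟩
          · rcases Finset.mem_insert.mp hx with rfl | hx
            · exact ⟨I, hI, hz⟩
            · exact hr x hx
          · rw [Finset.sup_insert, Finset.sup_insert]
            exact B.isS5.sup_left _ _ _ (B.isS5.mono _ _ _ _ le_rfl hyz le_sup_left)
              (B.isS5.mono _ _ _ _ le_rfl hr' le_sup_right)
      obtain ⟨r, hr, hr'⟩ := key
      exact ⟨r.sup id, ⟨r, hr, le_rfl⟩, B.isS5.mono _ _ _ _ hat hr' le_rfl⟩)

theorem mem_sSup {F : Set (RoundIdeal B)} {a : B} :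
    a ∈ sSup F ↔ ∃ t : Finset B, (∀ x ∈ t, ∃ I ∈ F, x ∈ I) ∧ a ≤ t.sup id := Iff.rfl

theorem finset_sup_mem (I : RoundIdeal B) (t : Finset B) (ht : ∀ x ∈ t, x ∈ I) :
    t.sup id ∈ I := by
  classical
  induction t using Finset.induction_on with
  | empty => simpa using I.bot_mem
  | insert y t _ ih =>
    rw [Finset.sup_insert]
    exact I.sup_mem (ht y (Finset.mem_insert_self _ _))
      (ih fun x hx => ht x (Finset.mem_insert_of_mem hx))

theorem isLUB_sSup' (F : Set (RoundIdeal B)) : IsLUB F (sSup F) := by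
  constructor
  · intro I hI a ha
    exact ⟨{a}, by simpa using ⟨I, hI, ha⟩, by simp⟩
  · intro J hJ a ha
    obtain ⟨t, ht, hat⟩ := mem_sSup.mp ha
    refine J.mem_of_le hat (J.finset_sup_mem t fun x hx => ?_)
    obtain ⟨I, hI, hxI⟩ := ht x hx
    exact hJ hI hxI

/-- The intersection of two round ideals. -/
def inter (I J : RoundIdeal B) : RoundIdeal B :=
  mk' {a | a ∈ I ∧ a ∈ J} ⟨I.bot_mem, J.bot_mem⟩
    (fun _ _ h hb => ⟨I.mem_of_le h hb.1, J.mem_of_le h hb.2⟩)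
    (fun _ _ ha hb => ⟨I.sup_mem ha.1 hb.1, J.sup_mem ha.2 hb.2⟩)
    (by
      rintro a ⟨haI, haJ⟩
      obtain ⟨b, hb, hab⟩ := I.exists_rel haI
      obtain ⟨c, hc, hac⟩ := J.exists_rel haJ
      exact ⟨b ⊓ c, ⟨I.mem_of_le inf_le_left hb, J.mem_of_le inf_le_right hc⟩,
        B.isS5.inf_right _ _ _ hab hac⟩)

/-- The improper ideal. -/
def univ : RoundIdeal B :=
  mk' Set.univ trivial (fun _ _ _ _ => trivial) (fun _ _ _ _ => trivial)
    (fun _ _ => ⟨⊤, trivial, B.isS5.mono _ _ _ _ le_top B.isS5.top_top le_rfl⟩)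

instance : CompleteLattice (RoundIdeal B) where
  __ := completeLatticeOfSup (RoundIdeal B) isLUB_sSup'
  inf := inter
  inf_le_left _ _ := fun _ h => h.1
  inf_le_right _ _ := fun _ h => h.2
  le_inf _ _ _ h₁ h₂ _ h := ⟨h₁ h, h₂ h⟩
  top := univ
  le_top _ := fun _ _ => trivial

theorem mem_inf {I J : RoundIdeal B} {a : B} : a ∈ I ⊓ J ↔ a ∈ I ∧ a ∈ J := Iff.rfl

theorem mem_top {a : B} : a ∈ (⊤ : RoundIdeal B) := trivial

theorem le_sSup_mem {F : Set (RoundIdeal B)} {I : RoundIdeal B} (hI : I ∈ F) {a : B}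
    (ha : a ∈ I) : a ∈ sSup F := (isLUB_sSup' F).1 hI ha

/-- The frame `RI(B, S)` of round ideals. -/
instance : Order.Frame (RoundIdeal B) := .ofMinimalAxioms
  { inf_sSup_le_iSup_inf := by
      classical
      intro I F a ha
      obtain ⟨haI, t, ht, hat⟩ := ha
      have h : a ≤ (t.image (a ⊓ ·)).sup id := by
        rw [Finset.sup_image, Function.id_comp]
        change a ≤ t.sup fun x => a ⊓ id x
        rw [← Finset.sup_inf_distrib_left]
        exact le_inf le_rfl hat
      refine mem_of_le _ h (finset_sup_mem _ _ fun x hx => ?_)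
      obtain ⟨y, hy, rfl⟩ := Finset.mem_image.mp hx
      obtain ⟨J, hJ, hyJ⟩ := ht y hy
      exact (le_iSup₂_of_le (f := fun b (_ : b ∈ F) => I ⊓ b) J hJ le_rfl)
        ⟨I.mem_of_le inf_le_left haI, J.mem_of_le inf_le_right hyJ⟩ }

theorem mem_sup {I J : RoundIdeal B} {a b : B} (ha : a ∈ I) (hb : b ∈ J) : a ⊔ b ∈ I ⊔ J :=
  sup_mem _ ((le_sup_left : I ≤ I ⊔ J) ha) ((le_sup_right : J ≤ I ⊔ J) hb)

theorem eq_top_of_top_mem {I : RoundIdeal B} (h : ⊤ ∈ I) : I = ⊤ :=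
  top_le_iff.mp fun _ _ => I.mem_of_le le_top h

/-- The round ideal `T⁻¹[I]` for a compatible subordination `T : A → B`. -/
def preimage {A : SubS5.{u}} (T : A ⟶ B) (I : RoundIdeal B) : RoundIdeal A :=
  mk' {a | ∃ b ∈ I, T.rel a b} ⟨⊥, I.bot_mem, T.isSubordination.bot_bot⟩
    (fun _ _ h ⟨b, hb, hT⟩ => ⟨b, hb, T.isSubordination.mono _ _ _ _ h hT le_rfl⟩)
    (fun _ _ ⟨b, hb, hT⟩ ⟨c, hc, hT'⟩ => ⟨b ⊔ c, I.sup_mem hb hc,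
      T.isSubordination.sup_left _ _ _ (T.isSubordination.mono _ _ _ _ le_rfl hT le_sup_left)
        (T.isSubordination.mono _ _ _ _ le_rfl hT' le_sup_right)⟩)
    (by
      rintro a ⟨b, hb, hT⟩
      rw [← T.comp_left] at hT
      obtain ⟨c, hac, hcb⟩ := hT
      exact ⟨c, ⟨b, hb, hcb⟩, hac⟩)

theorem mem_preimage {A : SubS5.{u}} {T : A ⟶ B} {I : RoundIdeal B} {a : A} :
    a ∈ preimage T I ↔ ∃ b ∈ I, T.rel a b := Iff.rfl

/-- The principal round ideal `S⁻¹[b]`. -/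
def below (b : B) : RoundIdeal B :=
  mk' {a | B.S a b} (B.isS5.mono _ _ _ _ le_rfl B.isS5.bot_bot bot_le)
    (fun _ _ h hb => B.isS5.mono _ _ _ _ h hb le_rfl)
    (fun _ _ h h' => B.isS5.sup_left _ _ _ h h')
    (fun _ h => by
      obtain ⟨c, hac, hcb⟩ := B.isS5.interpolate _ b h
      exact ⟨c, hcb, hac⟩)

theorem mem_sSup_directed {F : Set (RoundIdeal B)} (hF : F.Nonempty)
    (hd : DirectedOn (· ≤ ·) F) {a : B} : a ∈ sSup F ↔ ∃ I ∈ F, a ∈ I := by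
  classical
  refine ⟨?_, fun ⟨I, hI, ha⟩ => le_sSup_mem hI ha⟩
  rintro ⟨t, ht, hat⟩
  suffices h : ∃ I ∈ F, t.sup id ∈ I by
    obtain ⟨I, hI, h⟩ := h
    exact ⟨I, hI, I.mem_of_le hat h⟩
  clear hat
  induction t using Finset.induction_on with
  | empty =>
    obtain ⟨I, hI⟩ := hF
    exact ⟨I, hI, by simpa using I.bot_mem⟩
  | insert y t _ ih =>
    obtain ⟨I, hI, h⟩ := ih fun x hx => ht x (Finset.mem_insert_of_mem hx)
    obtain ⟨J, hJ, hy⟩ := ht y (Finset.mem_insert_self _ _)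
    obtain ⟨K, hK, hIK, hJK⟩ := hd I hI J hJ
    refine ⟨K, hK, ?_⟩
    rw [Finset.sup_insert]
    exact K.sup_mem (hJK hy) (hIK h)

theorem below_wellInside {J : RoundIdeal B} {b : B} (hb : b ∈ J) : WellInside (below b) J := by
  obtain ⟨c, hc, hbc⟩ := J.exists_rel hb
  have h : cᶜ ∈ (below b)ᶜ := by
    have hle : below bᶜ ≤ (below b)ᶜ := by
      rw [le_compl_iff_disjoint_right, disjoint_iff_inf_le]
      rintro x ⟨hx, hx'⟩
      have : x ≤ b ⊓ bᶜ := le_inf (B.isS5.le _ _ hx') (B.isS5.le _ _ hx)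
      rw [inf_compl_eq_bot] at this
      exact mem_of_le _ this (bot_mem _)
    exact hle (B.isS5.compl _ _ hbc)
  refine eq_top_of_top_mem ?_
  have := mem_sup h hc
  rwa [compl_sup_eq_top] at this

theorem isCompactRegular (B : SubS5.{u}) : IsCompactRegular (RoundIdeal B) where
  compact := by
    rw [CompleteLattice.isCompactElement_iff_le_of_directed_sSup_le]
    intro F hF hd h
    obtain ⟨I, hI, hI'⟩ := (mem_sSup_directed hF hd).mp (h (mem_top (a := ⊤)))
    exact ⟨I, hI, (eq_top_of_top_mem hI').ge⟩
  regular J := by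
    refine le_antisymm (sSup_le fun I hI => ?_) fun a ha => ?_
    · have h : I ⊓ (Iᶜ ⊔ J) = I := by rw [show Iᶜ ⊔ J = ⊤ from hI, inf_top_eq]
      rw [inf_sup_left, inf_compl_self, bot_sup_eq] at h
      exact inf_eq_left.mp h
    · obtain ⟨b, hb, hab⟩ := J.exists_rel ha
      exact le_sSup_mem (I := below b) (below_wellInside hb) hab

end RoundIdeal

/-- The contravariant functor `RI : SubS5^S → KRFrm^P`, sending `(B, S)` to its frame of round
ideals and `T : A → B` to `I ↦ T⁻¹[I]`. -/
def RI : SubS5.{u}ᵒᵖ ⥤ KRFrmP.{u} where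
  obj B := ⟨RoundIdeal B.unop, RoundIdeal.isCompactRegular B.unop⟩
  map {B A} T :=
    { toFun := RoundIdeal.preimage T.unop
      map_top := RoundIdeal.eq_top_of_top_mem
        ⟨⊤, RoundIdeal.mem_top, T.unop.isSubordination.top_top⟩
      map_inf := fun I J => by
        refine SetLike.ext fun a => ⟨?_, ?_⟩
        · rintro ⟨b, hb, hT⟩
          exact ⟨⟨b, hb.1, hT⟩, ⟨b, hb.2, hT⟩⟩
        · rintro ⟨⟨b, hb, hT⟩, ⟨c, hc, hT'⟩⟩
          exact ⟨b ⊓ c, ⟨I.mem_of_le inf_le_left hb, J.mem_of_le inf_le_right hc⟩,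
            T.unop.isSubordination.inf_right _ _ _ hT hT'⟩
      map_sSup := fun F hF hd => by
        have hd' : DirectedOn (· ≤ ·) (RoundIdeal.preimage T.unop '' F) := by
          rintro _ ⟨I, hI, rfl⟩ _ ⟨J, hJ, rfl⟩
          obtain ⟨K, hK, hIK, hJK⟩ := hd I hI J hJ
          exact ⟨_, ⟨K, hK, rfl⟩, fun _ ⟨b, hb, h⟩ => ⟨b, hIK hb, h⟩,
            fun _ ⟨b, hb, h⟩ => ⟨b, hJK hb, h⟩⟩
        refine SetLike.ext fun a => ?_
        rw [RoundIdeal.mem_sSup_directed (hF.image _) hd', RoundIdeal.mem_preimage]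
        constructor
        · rintro ⟨b, hb, hT⟩
          obtain ⟨I, hI, hbI⟩ := (RoundIdeal.mem_sSup_directed hF hd).mp hb
          exact ⟨_, ⟨I, hI, rfl⟩, b, hbI, hT⟩
        · rintro ⟨_, ⟨I, hI, rfl⟩, b, hb, hT⟩
          exact ⟨b, RoundIdeal.le_sSup_mem hI hb, hT⟩ }
  map_id B := by
    refine PreframeHom.ext (funext fun I => SetLike.ext fun a => ⟨?_, I.exists_rel⟩)
    rintro ⟨b, hb, hab⟩
    exact I.mem_of_le (B.unop.isS5.le _ _ hab) hb
  map_comp T U := by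
    refine PreframeHom.ext (funext fun I => SetLike.ext fun a => ⟨?_, ?_⟩)
    · rintro ⟨b, hb, c, hc, hc'⟩
      exact ⟨c, ⟨b, hb, hc'⟩, hc⟩
    · rintro ⟨c, ⟨b, hb, hc'⟩, hc⟩
      exact ⟨b, hb, c, hc, hc'⟩

/-! ### Booleanization -/

namespace WellInside

variable {L : Type u} [Order.Frame L] {a b c d : L}

theorem le (h : WellInside a b) : a ≤ b := by
  have h' : a ⊓ (aᶜ ⊔ b) = a := by rw [show aᶜ ⊔ b = ⊤ from h, inf_top_eq]
  rw [inf_sup_left, inf_compl_self, bot_sup_eq] at h'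
  exact inf_eq_left.mp h'

theorem mono (hab : a ≤ b) (h : WellInside b c) (hcd : c ≤ d) : WellInside a d :=
  top_le_iff.mp (h.ge.trans (sup_le_sup (compl_le_compl hab) hcd))

theorem bot_left : WellInside (⊥ : L) a := by simp [WellInside]

theorem top_right : WellInside a (⊤ : L) := by simp [WellInside]

theorem sup_left (h : WellInside a c) (h' : WellInside b c) : WellInside (a ⊔ b) c := by
  unfold WellInside at *
  rw [compl_sup, sup_inf_right, h, h', inf_top_eq]

theorem inf_right (h : WellInside a b) (h' : WellInside a c) : WellInside a (b ⊓ c) := by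
  unfold WellInside at *
  rw [sup_inf_left, h, h', inf_top_eq]

theorem compl_compl_left (h : WellInside a b) : WellInside aᶜᶜ b := by
  unfold WellInside at *
  rwa [compl_compl_compl]

theorem compl (h : WellInside a b) : WellInside bᶜ aᶜ := by
  unfold WellInside at *
  exact top_le_iff.mp (h.ge.trans (sup_le le_sup_right (le_compl_compl.trans le_sup_left)))

end WellInside

namespace IsCompactRegular

variable {L : Type u} [Order.Frame L]

theorem exists_of_wellInside_sSup (hL : IsCompactRegular L) {b : L} {D : Set L}
    (hD : D.Nonempty) (hd : DirectedOn (· ≤ ·) D) (h : WellInside b (sSup D)) :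
    ∃ d ∈ D, WellInside b d := by
  have hc := (CompleteLattice.isCompactElement_iff_le_of_directed_sSup_le L ⊤).mp hL.compact
    ((bᶜ ⊔ ·) '' D) (hD.image _) (by
      rintro _ ⟨x, hx, rfl⟩ _ ⟨y, hy, rfl⟩
      obtain ⟨z, hz, hxz, hyz⟩ := hd x hx y hy
      exact ⟨_, ⟨z, hz, rfl⟩, sup_le_sup_left hxz _, sup_le_sup_left hyz _⟩) (by
      refine h.ge.trans (sup_le ?_ (sSup_le fun x hx => ?_))
      · obtain ⟨x, hx⟩ := hD
        exact le_sSup_of_le ⟨x, hx, rfl⟩ le_sup_left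
      · exact le_sSup_of_le ⟨x, hx, rfl⟩ le_sup_right)
  obtain ⟨_, ⟨d, hd, rfl⟩, h'⟩ := hc
  exact ⟨d, hd, top_le_iff.mp h'⟩

theorem nonempty_regular (a : L) :
    {x : L | Heyting.IsRegular x ∧ WellInside x a}.Nonempty :=
  ⟨⊥, Heyting.isRegular_bot, WellInside.bot_left⟩

theorem directed_regular (a : L) :
    DirectedOn (· ≤ ·) {x : L | Heyting.IsRegular x ∧ WellInside x a} := by
  rintro x ⟨_, hx⟩ y ⟨_, hy⟩
  exact ⟨(x ⊔ y)ᶜᶜ, ⟨Heyting.isRegular_compl _, (hx.sup_left hy).compl_compl_left⟩,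
    le_sup_left.trans le_compl_compl, le_sup_right.trans le_compl_compl⟩

theorem sSup_regular (hL : IsCompactRegular L) (a : L) :
    sSup {x : L | Heyting.IsRegular x ∧ WellInside x a} = a := by
  refine le_antisymm (sSup_le fun x hx => hx.2.le) ?_
  conv_lhs => rw [← hL.regular a]
  exact sSup_le fun x hx => le_compl_compl.trans
    (le_sSup ⟨Heyting.isRegular_compl _, WellInside.compl_compl_left hx⟩)

theorem interpolate (hL : IsCompactRegular L) {a b : L} (h : WellInside a b) :
    ∃ c, Heyting.IsRegular c ∧ WellInside a c ∧ WellInside c b := by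
  rw [← hL.sSup_regular b] at h
  obtain ⟨c, hc, hac⟩ := hL.exists_of_wellInside_sSup (nonempty_regular b) (directed_regular b) h
  exact ⟨c, hc.1, hac, hc.2⟩

theorem interpolate_map {M : Type u} [Order.Frame M] (hL : IsCompactRegular L)
    (hM : IsCompactRegular M) (f : PreframeHom L M) {b : M} {a : L}
    (h : WellInside b (f.toFun a)) :
    ∃ c, Heyting.IsRegular c ∧ WellInside b (f.toFun c) ∧ WellInside c a := by
  rw [← hL.sSup_regular a, f.map_sSup _ (nonempty_regular a) (directed_regular a)] at h
  obtain ⟨_, ⟨c, hc, rfl⟩, hbc⟩ := hM.exists_of_wellInside_sSup ((nonempty_regular a).image _) (by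
    rintro _ ⟨x, hx, rfl⟩ _ ⟨y, hy, rfl⟩
    obtain ⟨z, hz, hxz, hyz⟩ := directed_regular a x hx y hy
    exact ⟨_, ⟨z, hz, rfl⟩, f.monotone hxz, f.monotone hyz⟩) h
  exact ⟨c, hc.1, hbc, hc.2⟩

end IsCompactRegular

/-- The booleanization `{a | a = a**}` of a compact regular frame, with the restriction of the
well-inside relation. -/
def boolAlg (L : KRFrmP.{u}) : SubS5.{u} where
  carrier := Heyting.Regular L
  S a b := WellInside a.val b.val
  isS5 :=
    { bot_bot := WellInside.bot_left
      top_top := WellInside.top_right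
      sup_left := fun _ _ _ h h' => (h.sup_left h').compl_compl_left
      inf_right := fun _ _ _ h h' => h.inf_right h'
      mono := fun _ _ _ _ h h' h'' => h'.mono h h''
      le := fun _ _ h => h.le
      compl := fun _ _ h => h.compl
      interpolate := fun _ _ h => by
        obtain ⟨c, hc, h₁, h₂⟩ := L.isCompactRegular.interpolate h
        exact ⟨⟨c, hc⟩, h₁, h₂⟩ }

theorem boolAlg_isDeVries (L : KRFrmP.{u}) : IsDeVries (boolAlg L) := by
  refine ⟨fun a ha => ?_, fun s => ?_⟩
  · by_contra hcon
    refine ha (Heyting.Regular.coe_injective (le_bot_iff.mp ?_))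
    rw [← L.isCompactRegular.sSup_regular a.val]
    refine sSup_le fun x hx => ?_
    by_contra hx'
    exact hcon ⟨⟨x, hx.1⟩, fun h => hx' (congrArg Heyting.Regular.val h).le, hx.2⟩
  · refine ⟨⟨(sSup (Heyting.Regular.val '' s))ᶜᶜ, Heyting.isRegular_compl _⟩, ?_, ?_⟩
    · intro a ha
      exact (le_sSup (Set.mem_image_of_mem _ ha)).trans
        (le_compl_compl : _ ≤ (sSup (Heyting.Regular.val '' s))ᶜᶜ)
    · intro b hb
      have h : sSup (Heyting.Regular.val '' s) ≤ b.val := by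
        refine sSup_le ?_
        rintro _ ⟨a, ha, rfl⟩
        exact hb ha
      exact (compl_le_compl (compl_le_compl h)).trans b.prop.le

/-- The relation `b ≺ □ a` between booleanizations. -/
def boolMap {L M : KRFrmP.{u}} (f : L ⟶ M) : boolAlg M ⟶ boolAlg L where
  rel b a := WellInside b.val (PreframeHom.toFun f a.val)
  isSubordination :=
    { bot_bot := WellInside.bot_left
      top_top := by
        change WellInside _ (PreframeHom.toFun f ⊤)
        rw [PreframeHom.map_top f]
        exact WellInside.top_right
      sup_left := fun _ _ _ h h' => (h.sup_left h').compl_compl_left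
      inf_right := fun a c d h h' => by
        change WellInside _ (PreframeHom.toFun f (c.val ⊓ d.val))
        rw [PreframeHom.map_inf f]
        exact h.inf_right h'
      mono := fun _ _ _ _ h h' h'' => h'.mono h (PreframeHom.monotone f h'') }
  comp_left := by
    funext b a
    refine propext ⟨?_, fun h => ?_⟩
    · rintro ⟨c, hbc, hca⟩
      exact hca.mono hbc.le le_rfl
    · obtain ⟨c, hc, h₁, h₂⟩ := M.isCompactRegular.interpolate h
      exact ⟨⟨c, hc⟩, h₁, h₂⟩
  comp_right := by
    funext b a
    refine propext ⟨?_, fun h => ?_⟩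
    · rintro ⟨c, hbc, hca⟩
      exact hbc.mono le_rfl (PreframeHom.monotone f hca.le)
    · obtain ⟨c, hc, h₁, h₂⟩ :=
        L.isCompactRegular.interpolate_map M.isCompactRegular f h
      exact ⟨⟨c, hc⟩, h₁, h₂⟩

/-- The contravariant functor `𝔅 : KRFrm^P → DeV^S`, sending a frame to its booleanization and
`□ : L → M` to the relation `b ≺ □ a`. -/
def boolFunctor : KRFrmP.{u}ᵒᵖ ⥤ DeVS.{u} where
  obj L := ⟨boolAlg L.unop, boolAlg_isDeVries L.unop⟩
  map f := ObjectProperty.homMk (boolMap f.unop)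
  map_id L := ObjectProperty.hom_ext _ (SubS5.Hom.ext rfl)
  map_comp {L M N} f g := by
    refine ObjectProperty.hom_ext _ (SubS5.Hom.ext ?_)
    funext c a
    refine propext ⟨fun h => ?_, ?_⟩
    · obtain ⟨b, hb, h₁, h₂⟩ := M.unop.isCompactRegular.interpolate_map
        L.unop.isCompactRegular f.unop h
      exact ⟨⟨b, hb⟩, h₁, h₂⟩
    · rintro ⟨b, h₁, h₂⟩
      exact h₁.mono le_rfl (PreframeHom.monotone f.unop h₂.le)

/-- The relation `Q_B : B → 𝔅(RI(B))`, given by `a Q_B I` iff `a ∈ I`. -/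
def relQ (B : SubS5.{u}) (a : B) (I : boolAlg (RI.obj (op B))) : Prop :=
  a ∈ (show RoundIdeal B from I.val)

/-- The subset `f_L(a) = {b | b ≺ a}` of the booleanization of `L`. -/
def setF (L : KRFrmP.{u}) (a : L) : Set (boolAlg L) := {b | WellInside b.val a}

/-! ### Restriction of an equivalence along two functors -/

section Restriction

variable {C : Type u} [Category.{v} C] {D : Type w} [Category.{v'} D]
  {C' : Type w'} [Category.{v₁} C'] {D' : Type w₁} [Category.{v₂} D']

/-- An equivalence `e : C ≌ D` restricts to `e' : C' ≌ D'` along `I : C' ⥤ C` and `J : D' ⥤ D`: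
the two functors and the unit and counit of `e'` are the restrictions of those of `e`. -/
structure RestrictsTo (e : C ≌ D) (e' : C' ≌ D') (I : C' ⥤ C) (J : D' ⥤ D) : Prop where
  functor_eq : e'.functor ⋙ J = I ⋙ e.functor
  inverse_eq : e'.inverse ⋙ I = J ⋙ e.inverse
  unit_eq : ∀ X : C', I.map (e'.unit.app X) ≫
    eqToHom ((Functor.congr_obj inverse_eq (e'.functor.obj X)).trans
      (congrArg e.inverse.obj (Functor.congr_obj functor_eq X))) = e.unit.app (I.obj X)
  counit_eq : ∀ Y : D', J.map (e'.counit.app Y) =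
    eqToHom ((Functor.congr_obj functor_eq (e'.inverse.obj Y)).trans
      (congrArg e.functor.obj (Functor.congr_obj inverse_eq Y))) ≫ e.counit.app (J.obj Y)

end Restriction

end S5Sub

open S5Sub

/-! Two approximations carry the equivalence. A round ideal `J` is the directed join of the ideals
`below a` = S⁻¹[a] with `a ∈ J`, and in a compact regular frame every element is the directed join
of the regular elements well inside it. By compactness, an element well inside a directed join is
well inside one of its members. So `I ≺ J` holds iff `I ≺ below a` for some `a ∈ J`
(`exists_wellInside_below`), and `a ∈ J` holds iff `a ∈ I ≺ J` for some regular `I`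
(`exists_mem_regular`).

These facts show that Q has as inverse the relation `I ≺ below a`, that both are natural, and that
RI sends the inverse of Q at B to f at RI(B), which is the triangle identity. The map f is an order
isomorphism whose inverse takes the join of an ideal in the frame.

For the wide subcategories, a continuous `T` gives a c-morphism with ◇J the set of all `x` such
that, for some `b ∈ J`, `x` is S-below all of T̂[b]. Conversely, ◇ provides the continuity witness
(◇b)** for the relation attached to □. Finally Q, f and their inverses lie in the wide
subcategories: Q and its inverse by computing with complements in the frame of round ideals, f and
its inverse because an order isomorphism is its own ◇.

Since 𝔅 takes values in de Vries algebras and these form a full subcategory, the same components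
prove the second part. -/

namespace S5Sub

/-! ### Joins, complements and approximation in the frame of round ideals -/

namespace RoundIdeal

variable {B : SubS5.{u}}

theorem mem_bot {a : B} : a ∈ (⊥ : RoundIdeal B) ↔ a = ⊥ := by
  refine ⟨fun h => ?_, fun h => h ▸ bot_mem _⟩
  have hle : (⊥ : RoundIdeal B) ≤ below ⊥ := bot_le
  exact le_bot_iff.mp (B.isS5.le _ _ (hle h))

theorem eq_bot_of_mem_of_mem_compl {I : RoundIdeal B} {a b : B} (ha : a ∈ I) (hb : b ∈ Iᶜ) :
    a ⊓ b = ⊥ := by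
  rw [← mem_bot, ← inf_compl_self I]
  exact ⟨I.mem_of_le inf_le_left ha, Iᶜ.mem_of_le inf_le_right hb⟩

/-- The elements lying under some `i ⊔ j` already form a round ideal containing `I` and `J`;
roundness is inherited because `S` is compatible with joins. -/
theorem exists_le_sup {I J : RoundIdeal B} {a : B} (h : a ∈ I ⊔ J) :
    ∃ i ∈ I, ∃ j ∈ J, a ≤ i ⊔ j := by
  let K : RoundIdeal B := mk' {a | ∃ i ∈ I, ∃ j ∈ J, a ≤ i ⊔ j}
    ⟨⊥, I.bot_mem, ⊥, J.bot_mem, bot_le⟩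
    (fun _ _ h ⟨i, hi, j, hj, hb⟩ => ⟨i, hi, j, hj, h.trans hb⟩)
    (fun _ _ ⟨i, hi, j, hj, ha⟩ ⟨k, hk, l, hl, hb⟩ =>
      ⟨i ⊔ k, I.sup_mem hi hk, j ⊔ l, J.sup_mem hj hl,
        (sup_le_sup ha hb).trans (sup_sup_sup_comm _ _ _ _).le⟩)
    (by
      rintro a ⟨i, hi, j, hj, ha⟩
      obtain ⟨k, hk, hik⟩ := I.exists_rel hi
      obtain ⟨l, hl, hjl⟩ := J.exists_rel hj
      refine ⟨k ⊔ l, ⟨k, hk, l, hl, le_rfl⟩, B.isS5.mono _ _ _ _ ha ?_ le_rfl⟩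
      exact B.isS5.sup_left _ _ _ (B.isS5.mono _ _ _ _ le_rfl hik le_sup_left)
        (B.isS5.mono _ _ _ _ le_rfl hjl le_sup_right))
  have hle : I ⊔ J ≤ K := sup_le (fun i hi => ⟨i, hi, ⊥, J.bot_mem, le_sup_left⟩)
    (fun j hj => ⟨⊥, I.bot_mem, j, hj, le_sup_right⟩)
  exact hle h

theorem below_mono {a b : B} (h : a ≤ b) : below a ≤ below b :=
  fun _ hx => B.isS5.mono _ _ _ _ le_rfl hx h

theorem below_le {I : RoundIdeal B} {a : B} (h : a ∈ I) : below a ≤ I :=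
  fun _ hx => I.mem_of_le (B.isS5.le _ _ hx) h

theorem below_top : below (⊤ : B) = ⊤ := eq_top_of_top_mem B.isS5.top_top

theorem below_inf (a b : B) : below (a ⊓ b) = below a ⊓ below b :=
  le_antisymm (le_inf (below_mono inf_le_left) (below_mono inf_le_right))
    fun _ hx => B.isS5.inf_right _ _ _ hx.1 hx.2

/-- An interpolant `c` between `a` and `b` splits `⊤` as `c ⊔ cᶜ`, with one half in each ideal. -/
theorem below_sup_below_compl {a b : B} (h : B.S a b) : below b ⊔ below aᶜ = ⊤ := by
  obtain ⟨c, hac, hcb⟩ := B.isS5.interpolate _ _ h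
  refine eq_top_of_top_mem ?_
  have := mem_sup (I := below b) (J := below aᶜ) hcb (B.isS5.compl _ _ hac)
  rwa [sup_compl_eq_top] at this

theorem below_inf_below_compl {a b : B} (h : a ≤ b) : below a ⊓ below bᶜ = ⊥ := by
  refine le_bot_iff.mp fun x hx => mem_bot.mpr (le_bot_iff.mp ?_)
  rw [← inf_compl_eq_bot (a := b)]
  exact le_inf ((B.isS5.le _ _ hx.1).trans h) (B.isS5.le _ _ hx.2)

theorem nonempty_below (I : RoundIdeal B) : (below '' {a | a ∈ I}).Nonempty :=
  ⟨_, ⊥, I.bot_mem, rfl⟩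

theorem directed_below (I : RoundIdeal B) : DirectedOn (· ≤ ·) (below '' {a | a ∈ I}) := by
  rintro _ ⟨a, ha, rfl⟩ _ ⟨b, hb, rfl⟩
  exact ⟨_, ⟨a ⊔ b, I.sup_mem ha hb, rfl⟩, below_mono le_sup_left, below_mono le_sup_right⟩

theorem sSup_below (I : RoundIdeal B) : sSup (below '' {a | a ∈ I}) = I := by
  refine le_antisymm (sSup_le ?_) fun a ha => ?_
  · rintro _ ⟨a, ha, rfl⟩
    exact below_le ha
  · obtain ⟨b, hb, hab⟩ := I.exists_rel ha
    exact le_sSup_mem (Set.mem_image_of_mem below hb) hab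

/-- Compactness, applied to `J` as the directed join of the ideals `below a` with `a ∈ J`. -/
theorem exists_wellInside_below {I J : RoundIdeal B} (h : WellInside I J) :
    ∃ a ∈ J, WellInside I (below a) := by
  rw [← sSup_below J] at h
  obtain ⟨_, ⟨a, ha, rfl⟩, h'⟩ :=
    (isCompactRegular B).exists_of_wellInside_sSup J.nonempty_below J.directed_below h
  exact ⟨a, ha, h'⟩

/-- A directed join of round ideals is their union, and `J` is the directed join of the regular
ideals well inside it. -/
theorem exists_mem_regular {J : RoundIdeal B} {a : B} (h : a ∈ J) :
    ∃ I : RoundIdeal B, Heyting.IsRegular I ∧ a ∈ I ∧ WellInside I J := by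
  rw [← (isCompactRegular B).sSup_regular J, mem_sSup_directed
    (IsCompactRegular.nonempty_regular J) (IsCompactRegular.directed_regular J)] at h
  obtain ⟨I, ⟨hI, hIJ⟩, ha⟩ := h
  exact ⟨I, hI, ha, hIJ⟩

end RoundIdeal

/-! ### The isomorphism `Q` -/

open RoundIdeal

/-- The relation `relQ` as a morphism of `SubS5^S`. -/
def homQ (B : SubS5.{u}) : B ⟶ boolAlg (RI.obj (op B)) where
  rel := relQ B
  isSubordination :=
    { bot_bot := bot_mem _
      top_top := mem_top
      sup_left := fun _ _ I h h' => RoundIdeal.sup_mem (B := B) I.val h h'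
      inf_right := fun _ _ _ h h' => ⟨h, h'⟩
      mono := fun _ _ I _ h h' h'' => h'' (RoundIdeal.mem_of_le (B := B) I.val h h') }
  comp_left := by
    funext a I
    refine propext ⟨?_, fun h => ?_⟩
    · rintro ⟨b, hab, hb⟩
      exact RoundIdeal.mem_of_le (B := B) I.val (B.isS5.le _ _ hab) hb
    · obtain ⟨b, hb, hab⟩ := RoundIdeal.exists_rel (B := B) I.val h
      exact ⟨b, hab, hb⟩
  comp_right := by
    funext a J
    refine propext ⟨?_, fun h => ?_⟩
    · rintro ⟨I, ha, hIJ⟩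
      exact hIJ.le ha
    · obtain ⟨I, hI, ha, hIJ⟩ := exists_mem_regular (B := B) h
      exact ⟨⟨I, hI⟩, ha, hIJ⟩

/-- The inverse of `homQ`: the relation `I ≺ S⁻¹[a]`. -/
def homQInv (B : SubS5.{u}) : boolAlg (RI.obj (op B)) ⟶ B where
  rel I a := WellInside (L := RoundIdeal B) I.val (below a)
  isSubordination :=
    { bot_bot := WellInside.bot_left
      top_top := by
        rw [below_top]
        exact WellInside.top_right
      sup_left := fun _ _ _ h h' => (h.sup_left h').compl_compl_left
      inf_right := fun _ _ _ h h' => by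
        rw [below_inf]
        exact h.inf_right h'
      mono := fun _ _ _ _ h h' h'' => h'.mono h (below_mono h'') }
  comp_left := by
    funext I a
    refine propext ⟨?_, fun h => ?_⟩
    · rintro ⟨J, hIJ, hJ⟩
      exact hJ.mono hIJ.le le_rfl
    · obtain ⟨J, hJ, h₁, h₂⟩ := (isCompactRegular B).interpolate h
      exact ⟨⟨J, hJ⟩, h₁, h₂⟩
  comp_right := by
    funext I a
    refine propext ⟨?_, fun h => ?_⟩
    · rintro ⟨b, hb, hba⟩
      exact hb.mono le_rfl (below_le hba)
    · obtain ⟨b, hb, hIb⟩ := exists_wellInside_below h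
      exact ⟨b, hIb, hb⟩

/-- `Q` as an isomorphism of `SubS5^S`. -/
def isoQ (B : SubS5.{u}) : B ≅ boolAlg (RI.obj (op B)) where
  hom := homQ B
  inv := homQInv B
  hom_inv_id := by
    refine SubS5.Hom.ext ?_
    funext a b
    refine propext ⟨?_, fun h => ?_⟩
    · rintro ⟨I, ha, hI⟩
      exact hI.le ha
    · obtain ⟨I, hI, ha, hIb⟩ := exists_mem_regular (J := below b) h
      exact ⟨⟨I, hI⟩, ha, hIb⟩
  inv_hom_id := by
    refine SubS5.Hom.ext ?_
    funext I J
    refine propext ⟨?_, fun h => ?_⟩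
    · rintro ⟨a, hIa, ha⟩
      exact WellInside.mono le_rfl hIa (below_le ha)
    · obtain ⟨a, ha, hIa⟩ := exists_wellInside_below (B := B) h
      exact ⟨a, hIa, ha⟩

/-- Both sides say that `a` lies in T⁻¹[J]; on the right, a regular ideal is interpolated between
`a` and T⁻¹[J]. -/
theorem homQ_naturality {A B : SubS5.{u}} (T : A ⟶ B) :
    T ≫ homQ B = homQ A ≫ boolMap (RI.map T.op) := by
  refine SubS5.Hom.ext ?_
  funext a J
  refine propext ⟨fun h => ?_, ?_⟩
  · obtain ⟨b, hab, hb⟩ := h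
    obtain ⟨I, hI, ha, hIJ⟩ :=
      exists_mem_regular (J := preimage T J.val) (a := a) ⟨b, hb, hab⟩
    exact ⟨⟨I, hI⟩, ha, hIJ⟩
  · rintro ⟨I, ha, hIJ⟩
    obtain ⟨b, hb, hab⟩ := WellInside.le hIJ ha
    exact ⟨b, hab, hb⟩

/-- This is the form needed for the unit: a map from B to its double dual in the opposite category
is a morphism into B, so the unit is the inverse of Q. -/
theorem homQInv_naturality {A B : SubS5.{u}} (T : A ⟶ B) :
    boolMap (RI.map T.op) ≫ homQInv B = homQInv A ≫ T :=
  (Iso.eq_inv_comp (isoQ A)).mpr <| by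
    rw [← Category.assoc]
    exact (Iso.comp_inv_eq (isoQ B)).mpr (homQ_naturality T).symm

theorem isContinuous_homQ (B : SubS5.{u}) : IsContinuous (homQ B) := by
  intro I J h
  -- `I ≺ J` means I* ∨ J = 1, so `⊤` splits into `b` in I* and `d ∈ J`; the continuity witness is
  -- `bᶜ`.
  obtain ⟨b, hb, d, hd, hbd⟩ := exists_le_sup (B := B) (I := (I.val)ᶜ) (J := J.val)
    (a := ⊤) ((show _ = ⊤ from h).ge mem_top)
  have hbd : bᶜ ≤ d := by
    rw [← codisjoint_iff_compl_le_right]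
    exact codisjoint_iff_le_sup.mpr hbd
  obtain ⟨e, he, hde⟩ := RoundIdeal.exists_rel (B := B) J.val hd
  refine ⟨bᶜ, ?_, fun c hc => B.isS5.mono _ _ _ _ hbd hde ?_⟩
  · exact RoundIdeal.mem_of_le (B := B) _ (compl_compl b).le hb
  -- Here `cᶜ` lies in J* and `e ∈ J`, so they are disjoint and `e ≤ c`; thus `bᶜ ≤ d S e ≤ c`.
  · have := eq_bot_of_mem_of_mem_compl (B := B) he hc
    rwa [← sdiff_eq, sdiff_eq_bot_iff] at this

theorem isContinuous_homQInv (B : SubS5.{u}) : IsContinuous (homQInv B) := by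
  intro a b h
  -- The natural witness is `below b`, replaced by its double pseudocomplement in order to be
  -- regular.
  refine ⟨⟨(below b)ᶜᶜ, Heyting.isRegular_compl _⟩, ?_, fun J hJ => ?_⟩
  · change (below b)ᶜᶜᶜᶜ ⊔ below aᶜ = ⊤
    exact top_le_iff.mp ((below_sup_below_compl h).ge.trans
      (sup_le_sup_right (le_compl_compl.trans le_compl_compl) _))
  -- Pseudocomplementing `hJ` puts (below bᶜ)* well inside J** = J, and `below b` is contained in
  -- (below bᶜ)*.
  · have hJ' : WellInside (below bᶜ)ᶜ (J.val)ᶜᶜ := WellInside.compl hJ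
    refine WellInside.compl_compl_left (hJ'.mono ?_ (Heyting.Regular.prop J).le)
    rw [le_compl_iff_disjoint_right, disjoint_iff]
    exact below_inf_below_compl le_rfl

/-! ### The isomorphism `f` -/

/-- An order isomorphism of frames as a preframe homomorphism. -/
def PreframeHom.ofOrderIso {L M : Type u} [Order.Frame L] [Order.Frame M] (e : L ≃o M) :
    PreframeHom L M where
  toFun := e
  map_top := e.map_top
  map_inf := e.map_inf
  map_sSup s _ _ := by rw [e.map_sSup, sSup_image]

/-- An order isomorphism of compact regular frames as an isomorphism of `KRFrm^P`. -/
def KRFrmP.isoOfOrderIso {L M : KRFrmP.{u}} (e : L ≃o M) : L ≅ M where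
  hom := PreframeHom.ofOrderIso e
  inv := PreframeHom.ofOrderIso e.symm
  hom_inv_id := PreframeHom.ext (funext e.symm_apply_apply)
  inv_hom_id := PreframeHom.ext (funext e.apply_symm_apply)

/-- The isomorphism itself serves as ◇. -/
theorem isCMorphism_ofOrderIso {L M : KRFrmP.{u}} (e : L ≃o M) :
    IsCMorphism (KRFrmP.isoOfOrderIso e).hom :=
  ⟨⟨e, fun s => by rw [e.map_sSup, sSup_image]⟩, fun a b => (e.map_sup a b).le,
    fun a b => (e.map_inf a b).ge⟩

/-- The round ideal of the regular elements that are well inside `a`. -/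
def idealF (L : KRFrmP.{u}) (a : L) : RoundIdeal (boolAlg L) :=
  RoundIdeal.mk' (setF L a) WellInside.bot_left (fun _ _ h h' => WellInside.mono h h' le_rfl)
    (fun _ _ h h' => (WellInside.sup_left h h').compl_compl_left)
    (fun b h => by
      obtain ⟨c, hc, h₁, h₂⟩ := L.isCompactRegular.interpolate (a := b.val) h
      exact ⟨⟨c, hc⟩, h₂, h₁⟩)

/-- `f_L` as an order isomorphism; its inverse sends a round ideal to its join in `L`. -/
def orderIsoF (L : KRFrmP.{u}) : L ≃o RoundIdeal (boolAlg L) where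
  toFun := idealF L
  invFun I := sSup (Heyting.Regular.val '' (I : Set (boolAlg L)))
  left_inv a := by
    conv_rhs => rw [← L.isCompactRegular.sSup_regular a]
    refine congrArg sSup (Set.ext fun x => ?_)
    exact ⟨fun ⟨b, hb, h⟩ => h ▸ ⟨b.prop, hb⟩, fun ⟨hx, h⟩ => ⟨⟨x, hx⟩, h, rfl⟩⟩
  right_inv I := by
    refine SetLike.ext fun b => ⟨fun h => ?_, fun h => ?_⟩
    -- The ideal is directed in the frame too, so by compactness `b` is well inside a single member
    -- `c`.
    · obtain ⟨_, ⟨c, hc, rfl⟩, hbc⟩ := L.isCompactRegular.exists_of_wellInside_sSup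
        (D := Heyting.Regular.val '' (I : Set (boolAlg L))) ⟨_, ⊥, I.bot_mem, rfl⟩ (by
          rintro _ ⟨x, hx, rfl⟩ _ ⟨y, hy, rfl⟩
          have hx' : x ≤ x ⊔ y := le_sup_left
          have hy' : y ≤ x ⊔ y := le_sup_right
          exact ⟨_, ⟨x ⊔ y, I.sup_mem hx hy, rfl⟩, hx', hy'⟩) h
      exact I.mem_of_le hbc.le hc
    · obtain ⟨c, hc, hbc⟩ := I.exists_rel h
      exact WellInside.mono le_rfl hbc (le_sSup ⟨c, hc, rfl⟩)
  map_rel_iff' {a b} := by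
    refine ⟨fun h => ?_, fun h _ hx => WellInside.mono le_rfl hx h⟩
    rw [← L.isCompactRegular.sSup_regular a]
    exact sSup_le fun x hx => WellInside.le (h (show (⟨x, hx.1⟩ : boolAlg L) ∈ idealF L a from hx.2))

/-- `f_L` as an isomorphism of `KRFrm^P`. -/
def isoF (L : KRFrmP.{u}) : L ≅ RI.obj (op (boolAlg L)) :=
  KRFrmP.isoOfOrderIso (M := RI.obj (op (boolAlg L))) (orderIsoF L)

/-- Both sides describe `b ≺ □a`: since □ preserves directed joins, compactness gives a regular `c ≺
a` with `b ≺ □c`. -/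
theorem isoF_naturality {L M : KRFrmP.{u}} (f : L ⟶ M) :
    f ≫ (isoF M).hom = (isoF L).hom ≫ RI.map (boolMap f).op := by
  refine PreframeHom.ext (funext fun a =>
    SetLike.ext (A := RoundIdeal (boolAlg M)) fun b => ⟨fun h => ?_, ?_⟩)
  · obtain ⟨c, hc, h₁, h₂⟩ :=
      L.isCompactRegular.interpolate_map M.isCompactRegular f (b := b.val) h
    exact ⟨⟨c, hc⟩, h₂, h₁⟩
  · rintro ⟨c, hc, hbc⟩
    exact WellInside.mono le_rfl hbc (PreframeHom.monotone f (WellInside.le hc))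

/-- The source of the triangle identity: `J ≺ below a` for some `a ∈ I` amounts to `J ≺ I`. -/
theorem RI_map_homQInv (B : SubS5.{u}) :
    RI.map (homQInv B).op = (isoF (RI.obj (op B))).hom := by
  refine PreframeHom.ext (funext fun I =>
    SetLike.ext (A := RoundIdeal (boolAlg (RI.obj (op B)))) fun J => ⟨?_, fun h => ?_⟩)
  · rintro ⟨a, ha, hJ⟩
    exact WellInside.mono le_rfl hJ (below_le ha)
  · exact exists_wellInside_below (B := B) h

/-! ### Continuous subordinations and `c`-morphisms -/

namespace IsContinuous

variable {A B : SubS5.{u}} {T : A ⟶ B}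

/-- The round ideal `◇J` of a continuous compatible subordination. -/
def diamond (hT : IsContinuous T) (J : RoundIdeal B) : RoundIdeal A :=
  RoundIdeal.mk' {x | ∃ b ∈ J, ∀ c, hat T.rel b c → A.S x c}
    ⟨⊥, J.bot_mem, fun _ _ => A.isS5.mono _ _ _ _ le_rfl A.isS5.bot_bot bot_le⟩
    (fun _ _ h ⟨b, hb, hx⟩ => ⟨b, hb, fun c hc => A.isS5.mono _ _ _ _ h (hx c hc) le_rfl⟩)
    (fun _ _ ⟨b, hb, hx⟩ ⟨d, hd, hy⟩ => ⟨b ⊔ d, J.sup_mem hb hd, fun c hc =>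
      A.isS5.sup_left _ _ _
        (hx c (T.isSubordination.mono _ _ _ _ le_rfl hc (compl_le_compl le_sup_left)))
        (hy c (T.isSubordination.mono _ _ _ _ le_rfl hc (compl_le_compl le_sup_right)))⟩)
    (by
      rintro x ⟨b, hb, hx⟩
      obtain ⟨d, hd, hbd⟩ := J.exists_rel hb
      obtain ⟨a, ha, ha'⟩ := hT _ _ hbd
      exact ⟨a, ⟨d, hd, ha'⟩, hx a ha⟩)

/-- Continuity at `b S d` with `d ∈ J` gives an element of T̂[b] that `d` certifies as a member of
◇J. -/
theorem exists_hat_mem_diamond (hT : IsContinuous T) {J : RoundIdeal B} {b : B} (hb : b ∈ J) :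
    ∃ a ∈ hT.diamond J, hat T.rel b a := by
  obtain ⟨d, hd, hbd⟩ := J.exists_rel hb
  obtain ⟨a, ha, ha'⟩ := hT _ _ hbd
  exact ⟨a, ⟨d, hd, ha'⟩, ha⟩

theorem diamond_mono (hT : IsContinuous T) : Monotone hT.diamond :=
  fun _ _ h _ ⟨b, hb, hx⟩ => ⟨b, h hb, hx⟩

theorem diamond_sSup (hT : IsContinuous T) (F : Set (RoundIdeal B)) :
    hT.diamond (sSup F) = sSup (hT.diamond '' F) := by
  classical
  refine le_antisymm ?_ (sSup_le ?_)
  · rintro x ⟨b, ⟨t, ht, hbt⟩, hx⟩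
    -- Since `x` is S-below all of T̂[b], it is enough to find one element of T̂[b] in the join; T̂
    -- of the finite join is contained in T̂[b].
    suffices h : ∃ a ∈ sSup (hT.diamond '' F), hat T.rel (t.sup id) a by
      obtain ⟨a, ha, hta⟩ := h
      have hba := hx a
        (T.isSubordination.mono _ _ _ _ le_rfl hta (compl_le_compl hbt))
      exact RoundIdeal.mem_of_le _ (A.isS5.le _ _ hba) ha
    clear hbt
    induction t using Finset.induction_on with
    | empty =>
      refine ⟨⊥, bot_mem _, ?_⟩
      change T.rel ⊥ᶜ ⊥ᶜ
      rw [compl_bot, compl_bot]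
      exact T.isSubordination.top_top
    | insert y t _ ih =>
      obtain ⟨a, ha, hta⟩ := ih fun z hz => ht z (Finset.mem_insert_of_mem hz)
      obtain ⟨I, hI, hy⟩ := ht y (Finset.mem_insert_self _ _)
      obtain ⟨d, hd, hyd⟩ := hT.exists_hat_mem_diamond hy
      -- T̂ respects binary joins, because `T` respects meets on the right.
      refine ⟨d ⊔ a, RoundIdeal.sup_mem _ (le_sSup_mem (Set.mem_image_of_mem hT.diamond hI) hd) ha, ?_⟩
      change T.rel (d ⊔ a)ᶜ ((insert y t).sup id)ᶜ
      rw [Finset.sup_insert, compl_sup, compl_sup]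
      exact T.isSubordination.inf_right _ _ _
        (T.isSubordination.mono _ _ _ _ inf_le_left hyd le_rfl)
        (T.isSubordination.mono _ _ _ _ inf_le_right hta le_rfl)
  · rintro _ ⟨I, hI, rfl⟩
    exact hT.diamond_mono (le_sSup hI)

/-- If `x T i ⊔ j` and `a ∈ ◇J` satisfies `aᶜ T jᶜ`, then `x ⊓ aᶜ T (i ⊔ j) ⊓ jᶜ ≤ i`. So `x` lies
under the join of `x ⊓ aᶜ` in □I and `a` in ◇J. -/
theorem preimage_sup_le (hT : IsContinuous T) (I J : RoundIdeal B) :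
    preimage T (I ⊔ J) ≤ preimage T I ⊔ hT.diamond J := by
  rintro x ⟨b, hb, hxb⟩
  obtain ⟨i, hi, j, hj, hbij⟩ := exists_le_sup hb
  obtain ⟨a, ha, hja⟩ := hT.exists_hat_mem_diamond hj
  have h : x ⊓ aᶜ ∈ preimage T I := by
    refine ⟨i, hi, T.isSubordination.mono _ _ _ _ le_rfl (T.isSubordination.inf_right _ _ _
      (T.isSubordination.mono _ _ _ _ inf_le_left hxb hbij)
      (T.isSubordination.mono _ _ _ _ inf_le_right hja le_rfl)) ?_⟩
    rw [inf_sup_right, inf_compl_eq_bot, sup_bot_eq]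
    exact inf_le_left
  refine RoundIdeal.mem_of_le _ ?_ (mem_sup h ha)
  rw [sup_inf_right, compl_sup_eq_top, inf_top_eq]
  exact le_sup_left

theorem preimage_inf_diamond_le (hT : IsContinuous T) (I J : RoundIdeal B) :
    preimage T I ⊓ hT.diamond J ≤ hT.diamond (I ⊓ J) := by
  intro x hx
  -- The argument below yields only `y ≤ c`; passing from `x` to `y` by roundness turns this into `x
  -- S c`.
  obtain ⟨y, ⟨⟨i, hi, hyi⟩, ⟨j, hj, hy⟩⟩, hxy⟩ := RoundIdeal.exists_rel _ hx
  refine ⟨i ⊓ j, ⟨I.mem_of_le inf_le_left hi, J.mem_of_le inf_le_right hj⟩, fun c hc => ?_⟩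
  refine A.isS5.mono _ _ _ _ le_rfl hxy ?_
  -- From `y T i` and `cᶜ T (i ⊓ j)ᶜ` follows `y ⊓ cᶜ T i ⊓ (iᶜ ⊔ jᶜ) ≤ jᶜ`. As `y` is S-below
  -- T̂[j], `y ≤ yᶜ ⊔ c`, hence `y ≤ c`.
  have h : hat T.rel j (yᶜ ⊔ c) := by
    change T.rel (yᶜ ⊔ c)ᶜ jᶜ
    rw [compl_sup, compl_compl]
    refine T.isSubordination.mono _ _ _ _ le_rfl (T.isSubordination.inf_right _ _ _
      (T.isSubordination.mono _ _ _ _ inf_le_left hyi le_rfl)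
      (T.isSubordination.mono _ _ _ _ inf_le_right hc le_rfl)) ?_
    rw [compl_inf, inf_sup_left, inf_compl_eq_bot, bot_sup_eq]
    exact inf_le_right
  have h' : y ≤ y ⊓ (yᶜ ⊔ c) := le_inf le_rfl (A.isS5.le _ _ (hy _ h))
  rw [inf_sup_left, inf_compl_eq_bot, bot_sup_eq] at h'
  exact h'.trans inf_le_right

theorem isCMorphism_RI_map (hT : IsContinuous T) : IsCMorphism (RI.map T.op) :=
  ⟨⟨hT.diamond, hT.diamond_sSup⟩, hT.preimage_sup_le, hT.preimage_inf_diamond_le⟩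

end IsContinuous

theorem IsCMorphism.isContinuous_boolMap {L M : KRFrmP.{u}} {f : L ⟶ M} (hf : IsCMorphism f) :
    IsContinuous (boolMap f) := by
  obtain ⟨d, hd, hd'⟩ := hf
  intro a b h
  -- The witness is (◇b)**. The first law at a* ∨ b = 1 gives □a* ∨ ◇b = 1, so it lies in T̂[a].
  refine ⟨⟨(d b.val)ᶜᶜ, Heyting.isRegular_compl _⟩, ?_, fun c hc => ?_⟩
  · change (d b.val)ᶜᶜᶜᶜ ⊔ PreframeHom.toFun f (a.val)ᶜ = ⊤
    have h' := hd (a.val)ᶜ b.val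
    rw [show (a.val)ᶜ ⊔ b.val = ⊤ from h, PreframeHom.map_top f, sup_comm] at h'
    exact top_le_iff.mp (h'.trans
      (sup_le_sup_right (le_compl_compl.trans le_compl_compl) _))
  -- Pseudocomplementing `hc` gives (□b*)* ≺ c** = c, and ◇b ≤ (□b*)* because the second law bounds
  -- □b* ∧ ◇b by ◇0 = 0.
  · have hc' : WellInside (PreframeHom.toFun f (b.val)ᶜ)ᶜ (c.val)ᶜᶜ := WellInside.compl hc
    refine WellInside.compl_compl_left (hc'.mono ?_ (Heyting.Regular.prop c).le)
    rw [le_compl_iff_disjoint_left, disjoint_iff_inf_le]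
    refine (hd' _ _).trans ?_
    rw [compl_inf_self, map_bot]

/-! ### Restriction of a dual equivalence to wide subcategories -/

section Restriction

variable {C : Type u} [Category.{v} C] {D : Type w} [Category.{v'} D]

/-- A wide subcategory need not contain inverses of its morphisms, so the unit, the counit and both
their inverses have to be assumed to lie in it. -/
theorem exists_restrictsTo_wideSubcategory (e : Cᵒᵖ ≌ D) (P : MorphismProperty C)
    [P.IsMultiplicative] (Q : MorphismProperty D) [Q.IsMultiplicative]
    (hF : ∀ {X Y : C} (f : X ⟶ Y), P f → Q (e.functor.map f.op))
    (hG : ∀ {X Y : D} (g : X ⟶ Y), Q g → P (e.inverse.map g).unop)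
    (hη : ∀ X : C, P (e.unitIso.hom.app (op X)).unop)
    (hη' : ∀ X : C, P (e.unitIso.inv.app (op X)).unop)
    (hε : ∀ Y : D, Q (e.counitIso.hom.app Y)) (hε' : ∀ Y : D, Q (e.counitIso.inv.app Y)) :
    ∃ e' : (WideSubcategory P)ᵒᵖ ≌ WideSubcategory Q,
      RestrictsTo e e' (wideSubcategoryInclusion P).op (wideSubcategoryInclusion Q) := by
  let F : (WideSubcategory P)ᵒᵖ ⥤ WideSubcategory Q :=
    { obj := fun X => ⟨e.functor.obj (op X.unop.obj)⟩
      map := fun f => ⟨e.functor.map f.unop.hom.op, hF _ f.unop.property⟩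
      map_id := fun X => WideSubcategory.hom_ext _ (e.functor.map_id _)
      map_comp := fun f g => WideSubcategory.hom_ext _ (e.functor.map_comp f.unop.hom.op g.unop.hom.op) }
  let G : WideSubcategory Q ⥤ (WideSubcategory P)ᵒᵖ :=
    { obj := fun Y => op ⟨(e.inverse.obj Y.obj).unop⟩
      map := fun g => Quiver.Hom.op ⟨(e.inverse.map g.hom).unop, hG _ g.property⟩
      map_id := fun Y => Quiver.Hom.unop_inj (WideSubcategory.hom_ext _
        (congrArg Quiver.Hom.unop (e.inverse.map_id _)))
      map_comp := fun f g => Quiver.Hom.unop_inj (WideSubcategory.hom_ext _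
        (congrArg Quiver.Hom.unop (e.inverse.map_comp _ _))) }
  let η : 𝟭 (WideSubcategory P)ᵒᵖ ≅ F ⋙ G := NatIso.ofComponents
    (fun X => (WideSubcategory.isoMk (X := (G.obj (F.obj X)).unop) (Y := X.unop)
      (e.unitIso.app (op X.unop.obj)).unop (hη _) (hη' _)).op)
    (fun f => Quiver.Hom.unop_inj (WideSubcategory.hom_ext _
      (congrArg Quiver.Hom.unop (e.unitIso.hom.naturality f.unop.hom.op))))
  let ε : G ⋙ F ≅ 𝟭 (WideSubcategory Q) := NatIso.ofComponents
    (fun Y => WideSubcategory.isoMk (X := F.obj (G.obj Y)) (Y := Y)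
      (e.counitIso.app Y.obj) (hε _) (hε' _))
    (fun f => WideSubcategory.hom_ext _ (e.counitIso.hom.naturality f.hom))
  refine ⟨Equivalence.mk' F G η ε fun X => WideSubcategory.hom_ext _
    (e.functor_unitIso_comp (op X.unop.obj)), rfl, rfl, fun X => ?_, fun Y => ?_⟩
  -- The squares of functors commute definitionally, so the `eqToHom` factors are identities.
  · exact Category.comp_id _
  · exact (Category.id_comp _).symm

end Restriction

/-! ### The dual equivalences -/

/-- The unit on `SubS5^S`. -/
def unitSubS5 : 𝟭 SubS5.{u}ᵒᵖ ≅ RI ⋙ boolFunctor.rightOp ⋙ inclΔ.op :=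
  NatIso.ofComponents (fun B => (isoQ B.unop).symm.op)
    fun T => Quiver.Hom.unop_inj (homQInv_naturality T.unop).symm

/-- The unit on `DeV^S`. -/
def unitDeV : 𝟭 DeVS.{u}ᵒᵖ ≅ (inclΔ.op ⋙ RI) ⋙ boolFunctor.rightOp :=
  NatIso.ofComponents
    (fun B => (ObjectProperty.isoMk IsDeVries (X := B.unop)
      (Y := boolFunctor.obj (op (RI.obj (op B.unop.obj)))) (isoQ B.unop.obj)).symm.op)
    fun T => Quiver.Hom.unop_inj
      (ObjectProperty.hom_ext _ (homQInv_naturality T.unop.hom).symm)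

/-- The counit. -/
def counitRI : (boolFunctor.rightOp ⋙ inclΔ.op) ⋙ RI ≅ 𝟭 KRFrmP.{u} :=
  (NatIso.ofComponents (F := 𝟭 KRFrmP.{u}) (G := (boolFunctor.rightOp ⋙ inclΔ.op) ⋙ RI)
    isoF isoF_naturality).symm

theorem RI_map_homQInv_comp (B : SubS5.{u}) :
    RI.map (homQInv B).op ≫ (isoF (RI.obj (op B))).inv = 𝟙 (RI.obj (op B)) := by
  rw [RI_map_homQInv, Iso.hom_inv_id]

end S5Sub

open S5Sub

theorem mainTheorem4 :
    (∃ (η : 𝟭 SubS5.{u}ᵒᵖ ≅ RI ⋙ boolFunctor.rightOp ⋙ inclΔ.op)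
        (ε : (boolFunctor.rightOp ⋙ inclΔ.op) ⋙ RI ≅ 𝟭 KRFrmP.{u})
        (tri : ∀ B, RI.map (η.hom.app B) ≫ ε.hom.app (RI.obj B) = 𝟙 (RI.obj B)),
      (∀ B : SubS5.{u}, (η.inv.app (op B)).unop.rel = relQ B) ∧
      (∀ (L : KRFrmP.{u}) (a : L),
        ((PreframeHom.toFun (ε.inv.app L) a : RoundIdeal (boolAlg L)) : Set (boolAlg L)) =
          setF L a) ∧
      ∃ e : SubS5CS.{u}ᵒᵖ ≌ KRFrmC.{u},
        RestrictsTo (Equivalence.mk' RI (boolFunctor.rightOp ⋙ inclΔ.op) η ε tri) e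
          (wideSubcategoryInclusion IsContinuous).op (wideSubcategoryInclusion IsCMorphism)) ∧
    (∃ (η : 𝟭 DeVS.{u}ᵒᵖ ≅ (inclΔ.op ⋙ RI) ⋙ boolFunctor.rightOp)
        (ε : boolFunctor.rightOp ⋙ inclΔ.op ⋙ RI ≅ 𝟭 KRFrmP.{u})
        (tri : ∀ B, (inclΔ.op ⋙ RI).map (η.hom.app B) ≫ ε.hom.app ((inclΔ.op ⋙ RI).obj B) =
          𝟙 ((inclΔ.op ⋙ RI).obj B)),
      (∀ B : DeVS.{u}, (η.inv.app (op B)).unop.hom.rel = relQ B.obj) ∧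
      (∀ (L : KRFrmP.{u}) (a : L),
        ((PreframeHom.toFun (ε.inv.app L) a : RoundIdeal (boolAlg L)) : Set (boolAlg L)) =
          setF L a) ∧
      ∃ e : DeVCS.{u}ᵒᵖ ≌ KRFrmC.{u},
        RestrictsTo (Equivalence.mk' (inclΔ.op ⋙ RI) boolFunctor.rightOp η ε tri) e
          (wideSubcategoryInclusion IsContinuousDeV).op
          (wideSubcategoryInclusion IsCMorphism)) := by
  refine ⟨⟨unitSubS5, counitRI, fun B => RI_map_homQInv_comp B.unop, fun _ => rfl,
    fun _ _ => rfl, ?_⟩, ⟨unitDeV, counitRI, fun B => RI_map_homQInv_comp B.unop.obj,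
    fun _ => rfl, fun _ _ => rfl, ?_⟩⟩
  · exact exists_restrictsTo_wideSubcategory _ _ _ (fun _ h => h.isCMorphism_RI_map)
      (fun _ h => h.isContinuous_boolMap) isContinuous_homQInv isContinuous_homQ
      (fun L => isCMorphism_ofOrderIso (L := RI.obj (op (boolAlg L))) (orderIsoF L).symm)
      (fun L => isCMorphism_ofOrderIso (M := RI.obj (op (boolAlg L))) (orderIsoF L))
  -- Continuity in DeV^S is continuity of the underlying morphism, so the facts used for the first
  -- part apply unchanged.
  · exact exists_restrictsTo_wideSubcategory _ _ _
      (fun _ h => IsContinuous.isCMorphism_RI_map h)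
      (fun _ h => h.isContinuous_boolMap) (fun B => isContinuous_homQInv B.obj)
      (fun B => isContinuous_homQ B.obj)
      (fun L => isCMorphism_ofOrderIso (L := RI.obj (op (boolAlg L))) (orderIsoF L).symm)
      (fun L => isCMorphism_ofOrderIso (M := RI.obj (op (boolAlg L))) (orderIsoF L))
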